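/- Let $\mathbb K$ be a field and $d\ge 0$ an integer. Let $V$ be a $\mathbb K$-vector space of dimension $d+1$. An element $A\in\mathrm{End}(V)$ is *multiplicity-free* if $V$ is spanned by the eigenspaces of $A$ and each eigenspace has dimension one; the *primitive idempotent* of $A$ for an eigenvalue $\theta$ is the element of $\mathrm{End}(V)$ that is the identity on the $\theta$-eigenspace and zero on all other eigenspaces. A *TH system of diameter $d$* on $V$ is a sequence $\Phi=(A;\{E_i\}_{i=0}^d;A^*;\{E^*_i\}_{i=0}^d)$ where $A,A^*\in\mathrm{End}(V)$ are multiplicity-free, $\{E_i\}_{i=0}^d$ (resp. $\{E_i^*\}_{i=0}^d$) is an ordering of the primitive idempotents of $A$ (resp. $A^*$), and for $0\le i,j\le d$ both $E_iA^*E_j$ and $E^*_iAE^*_j$ are zero if $i-j>1$ and nonzero if $i-j=1$. An isomorphism from $\Phi$ to a TH system $(B;\{F_i\};B^*;\{F_i^*\})$ on $W$ is a $\mathbb K$-algebra isomorphism $\gamma:\mathrm{End}(V)\to\mathrm{End}(W)$ sending $A,A^*,E_i,E_i^*$ to $B,B^*,F_i,F_i^*$ for all $i$. TH systems $\Phi,\Phi'$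 over $\mathbb K$ are *affine isomorphic* if $\Phi$ is isomorphic to $(\alpha A'+\beta I;\{E'_i\};\alpha^*A'^*+\beta^*I;\{E'^*_i\})$, where $\Phi'=(A';\{E'_i\};A'^*;\{E'^*_i\})$, for some $\alpha,\beta,\alpha^*,\beta^*\in\mathbb K$ with $\alpha,\alpha^*\ne0$. This is an equivalence relation. A *parameter array of diameter $d$* over $\mathbb K$ is a sequence $(\{\theta_i\}_{i=0}^d,\{\theta_i^*\}_{i=0}^d,\{\phi_i\}_{i=1}^d)$ of scalars in $\mathbb K$ with the $\theta_i$ mutually distinct, the $\theta^*_i$ mutually distinct, and all $\phi_i$ nonzero. The parameter array of $\Phi$ consists of the eigenvalues $\theta_i$ of $A$ for $E_i$, the eigenvalues $\theta^*_i$ of $A^*$ for $E^*_i$, and the scalars $\phi_i$ $(1\le i\le d)$ by which $(A-\theta_{d-i+1}I)(A^*-\theta_i^*I)$ acts on the nonzero subspace $$U_i=(E_0^*V+\cdots+E_i^*V)\cap(E_0V+\cdots+E_{d-i}V).$$ Two parameter arrays are *affine related* if there are $\alpha,\beta,\alpha^*,\beta^*\in\mathbb K$ with $\alpha,\alpha^*\neq0$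 such that the second is $(\{\alpha\theta_i+\beta\},\{\alpha^*\theta^*_i+\beta^*\},\{\alpha\alpha^*\phi_i\})$, where the first is $(\{\theta_i\},\{\theta_i^*\},\{\phi_i\})$. This is an equivalence relation, whose classes are the *reduced parameter arrays*. Then every TH system over $\mathbb K$ of diameter $d$ has exactly one parameter array, and the map sending a TH system to its parameter array induces a bijection $\pi$ from the set of isomorphism classes of TH systems over $\mathbb K$ of diameter $d$ to the set of parameter arrays over $\mathbb K$ of diameter $d$. Moreover, $\pi$ induces a bijection from the set of affine isomorphism classes of TH systems over $\mathbb K$ of diameter $d$ to the set of reduced parameter arrays over $\mathbb K$ of diameter $d$: the affine isomorphism class of $\Phi$ is sent to the class of the parameter array of $\Phi$. -/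

import Mathlib

universe u v w

namespace ThinHess

section LinearAlgebra

variable {K : Type u} [Field K] {V : Type v} [AddCommGroup V] [Module K V]

/-- `A` is multiplicity-free: `V` is spanned by the eigenspaces of `A`, and every eigenspace of `A`
has dimension one. -/
def IsMultiplicityFree (A : Module.End K V) : Prop :=
  (⨆ μ : K, A.eigenspace μ) = ⊤ ∧
    ∀ μ : K, A.HasEigenvalue μ → Module.finrank K (A.eigenspace μ) = 1

/-- `F` is the primitive idempotent of `A` corresponding to the eigenvalue `θ`: it acts as the
identity on the `θ`-eigenspace and annihilates every other eigenspace. -/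
def IsPrimitiveIdempotent (A : Module.End K V) (θ : K) (F : Module.End K V) : Prop :=
  A.HasEigenvalue θ ∧ (∀ x ∈ A.eigenspace θ, F x = x) ∧
    ∀ μ : K, μ ≠ θ → ∀ x ∈ A.eigenspace μ, F x = 0

/-- `E` lists all primitive idempotents of `A`, each exactly once. -/
def IsIdempotentOrdering (A : Module.End K V) {d : ℕ} (E : Fin (d + 1) → Module.End K V) : Prop :=
  Function.Injective E ∧ Set.range E = {F | ∃ θ : K, IsPrimitiveIdempotent A θ F}

/-- The condition that `E i * B * E j` vanishes if `i - j > 1` and is nonzero if `i - j = 1`. -/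
def IsHessenbergFor {d : ℕ} (E : Fin (d + 1) → Module.End K V) (B : Module.End K V) : Prop :=
  ∀ i j : Fin (d + 1), ((j : ℕ) + 1 < (i : ℕ) → E i * B * E j = 0) ∧
    ((i : ℕ) = (j : ℕ) + 1 → E i * B * E j ≠ 0)

end LinearAlgebra

/-- A thin Hessenberg system `(A; {E i}; A*; {E* i})` of diameter `d` on the vector space `V`. -/
structure THSystemOn (K : Type u) [Field K] (V : Type v) [AddCommGroup V] [Module K V]
    (d : ℕ) where
  A : Module.End K V
  E : Fin (d + 1) → Module.End K V
  Astar : Module.End K V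
  Estar : Fin (d + 1) → Module.End K V
  finrank_eq : Module.finrank K V = d + 1
  multFree : IsMultiplicityFree A
  multFree_star : IsMultiplicityFree Astar
  ordering : IsIdempotentOrdering A E
  ordering_star : IsIdempotentOrdering Astar Estar
  hessenberg : IsHessenbergFor E Astar
  hessenberg_star : IsHessenbergFor Estar A

section Affine

variable {K : Type u} [Field K] {V : Type v} [AddCommGroup V] [Module K V]

theorem eigenspace_affine (A : Module.End K V) {α : K} (hα : α ≠ 0) (β μ : K) :
    (α • A + β • (1 : Module.End K V)).eigenspace (α * μ + β) = A.eigenspace μ := by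
  ext x
  simp only [Module.End.mem_eigenspace_iff, LinearMap.add_apply, LinearMap.smul_apply,
    Module.End.one_apply, add_smul, mul_smul, add_left_inj]
  exact (smul_right_injective V hα).eq_iff

theorem affine_surj {α : K} (hα : α ≠ 0) (β ν : K) : ∃ μ : K, α * μ + β = ν :=
  ⟨α⁻¹ * (ν - β), by field_simp; ring⟩

theorem IsMultiplicityFree.affine {A : Module.End K V} (h : IsMultiplicityFree A) {α : K}
    (hα : α ≠ 0) (β : K) : IsMultiplicityFree (α • A + β • (1 : Module.End K V)) := by
  refine ⟨?_, fun ν hν => ?_⟩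
  · rw [eq_top_iff, ← h.1]
    refine iSup_le fun μ => ?_
    rw [← eigenspace_affine A hα β μ]
    exact le_iSup (fun ν => (α • A + β • (1 : Module.End K V)).eigenspace ν) (α * μ + β)
  · obtain ⟨μ, rfl⟩ := affine_surj hα β ν
    rw [Module.End.hasEigenvalue_iff, eigenspace_affine A hα] at hν
    rw [eigenspace_affine A hα]
    exact h.2 μ (Module.End.hasEigenvalue_iff.2 hν)

theorem isPrimitiveIdempotent_affine (A : Module.End K V) {α : K} (hα : α ≠ 0) (β θ : K)
    (F : Module.End K V) :
    IsPrimitiveIdempotent (α • A + β • (1 : Module.End K V)) (α * θ + β) F ↔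
      IsPrimitiveIdempotent A θ F := by
  unfold IsPrimitiveIdempotent
  rw [Module.End.hasEigenvalue_iff, Module.End.hasEigenvalue_iff, eigenspace_affine A hα]
  refine and_congr_right fun _ => and_congr_right fun _ => ⟨fun h μ hμ x hx => ?_,
    fun h ν hν x hx => ?_⟩
  · refine h (α * μ + β) (fun e => hμ ?_) x (by rwa [eigenspace_affine A hα])
    exact mul_left_cancel₀ hα (add_right_cancel e)
  · obtain ⟨μ, rfl⟩ := affine_surj hα β ν
    rw [eigenspace_affine A hα] at hx
    exact h μ (fun e => hν (by rw [e])) x hx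

theorem IsIdempotentOrdering.affine {A : Module.End K V} {d : ℕ}
    {E : Fin (d + 1) → Module.End K V} (h : IsIdempotentOrdering A E) {α : K} (hα : α ≠ 0)
    (β : K) : IsIdempotentOrdering (α • A + β • (1 : Module.End K V)) E := by
  refine ⟨h.1, ?_⟩
  rw [h.2]
  ext F
  constructor
  · rintro ⟨θ, hθ⟩
    exact ⟨α * θ + β, (isPrimitiveIdempotent_affine A hα β θ F).2 hθ⟩
  · rintro ⟨ν, hν⟩
    obtain ⟨θ, rfl⟩ := affine_surj hα β ν
    exact ⟨θ, (isPrimitiveIdempotent_affine A hα β θ F).1 hν⟩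

theorem IsIdempotentOrdering.mul_eq_zero {A : Module.End K V} (hA : IsMultiplicityFree A) {d : ℕ}
    {E : Fin (d + 1) → Module.End K V} (h : IsIdempotentOrdering A E) {i j : Fin (d + 1)}
    (hij : i ≠ j) : E i * E j = 0 := by
  have hE : ∀ i, ∃ θ : K, IsPrimitiveIdempotent A θ (E i) := fun i => by
    have : E i ∈ Set.range E := ⟨i, rfl⟩
    rwa [h.2] at this
  have key : ∀ p : Submodule K V, (∀ μ, A.eigenspace μ ≤ p) → ∀ x, x ∈ p := fun p hp x => by
    have : (⊤ : Submodule K V) ≤ p := hA.1 ▸ iSup_le hp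
    exact this trivial
  obtain ⟨θ, hθ⟩ := hE i
  obtain ⟨η, hη⟩ := hE j
  have hne : θ ≠ η := by
    rintro rfl
    refine hij (h.1 (LinearMap.ext fun x => ?_))
    refine key (LinearMap.eqLocus (E i) (E j)) (fun μ y hy => ?_) x
    rw [LinearMap.mem_eqLocus]
    by_cases hμ : μ = θ
    · subst hμ
      rw [hθ.2.1 y hy, hη.2.1 y hy]
    · rw [hθ.2.2 μ hμ y hy, hη.2.2 μ hμ y hy]
  refine LinearMap.ext fun x => ?_
  refine key (LinearMap.ker (E i * E j)) (fun μ y hy => ?_) x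
  rw [LinearMap.mem_ker, Module.End.mul_apply]
  by_cases hμ : μ = η
  · subst hμ
    rw [hη.2.1 y hy, hθ.2.2 μ hne.symm y hy]
  · rw [hη.2.2 μ hμ y hy, map_zero]

theorem IsHessenbergFor.affine {A B : Module.End K V} (hA : IsMultiplicityFree A) {d : ℕ}
    {E : Fin (d + 1) → Module.End K V} (hE : IsIdempotentOrdering A E)
    (h : IsHessenbergFor E B) {α : K} (hα : α ≠ 0) (β : K) :
    IsHessenbergFor E (α • B + β • (1 : Module.End K V)) := by
  intro i j
  have e : i ≠ j → E i * (α • B + β • (1 : Module.End K V)) * E j = α • (E i * B * E j) := by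
    intro hij
    have := hE.mul_eq_zero hA hij
    simp [mul_add, add_mul, this]
  refine ⟨fun hij => ?_, fun hij => ?_⟩
  · rw [e (by rintro rfl; omega), (h i j).1 hij, smul_zero]
  · rw [e (by rintro rfl; omega)]
    exact smul_ne_zero hα ((h i j).2 hij)

end Affine

namespace THSystemOn

variable {K : Type u} [Field K] {V : Type v} [AddCommGroup V] [Module K V]
  {W : Type w} [AddCommGroup W] [Module K W] {d : ℕ}

/-- The affine transformation `(αA + βI; {E i}; α*A* + β*I; {E* i})` of a TH system. -/
def affine (Φ : THSystemOn K V d) (α β αs βs : K) (hα : α ≠ 0) (hαs : αs ≠ 0) :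
    THSystemOn K V d where
  A := α • Φ.A + β • (1 : Module.End K V)
  E := Φ.E
  Astar := αs • Φ.Astar + βs • (1 : Module.End K V)
  Estar := Φ.Estar
  finrank_eq := Φ.finrank_eq
  multFree := Φ.multFree.affine hα β
  multFree_star := Φ.multFree_star.affine hαs βs
  ordering := Φ.ordering.affine hα β
  ordering_star := Φ.ordering_star.affine hαs βs
  hessenberg := Φ.hessenberg.affine Φ.multFree Φ.ordering hαs βs
  hessenberg_star := Φ.hessenberg_star.affine Φ.multFree_star Φ.ordering_star hα β

/-- `γ` is an isomorphism of TH systems from `Φ` to `Ψ`. -/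
def IsIsomorphism (Φ : THSystemOn K V d) (Ψ : THSystemOn K W d)
    (γ : Module.End K V ≃ₐ[K] Module.End K W) : Prop :=
  Ψ.A = γ Φ.A ∧ Ψ.Astar = γ Φ.Astar ∧
    (∀ i, Ψ.E i = γ (Φ.E i)) ∧ ∀ i, Ψ.Estar i = γ (Φ.Estar i)

/-- Two TH systems are isomorphic. -/
def Isomorphic (Φ : THSystemOn K V d) (Ψ : THSystemOn K W d) : Prop :=
  ∃ γ : Module.End K V ≃ₐ[K] Module.End K W, IsIsomorphism Φ Ψ γ

/-- `Φ` is affine isomorphic to `Ψ`: it is isomorphic to an affine transformation of `Ψ`. -/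
def AffineIsomorphic (Φ : THSystemOn K V d) (Ψ : THSystemOn K W d) : Prop :=
  ∃ (α β αs βs : K) (hα : α ≠ 0) (hαs : αs ≠ 0),
    Isomorphic Φ (Ψ.affine α β αs βs hα hαs)

/-- `θ` is the eigenvalue sequence of `Φ`. -/
def IsEigenvalueSeq (Φ : THSystemOn K V d) (θ : Fin (d + 1) → K) : Prop :=
  ∀ i, IsPrimitiveIdempotent Φ.A (θ i) (Φ.E i)

/-- `θs` is the dual eigenvalue sequence of `Φ`. -/
def IsDualEigenvalueSeq (Φ : THSystemOn K V d) (θs : Fin (d + 1) → K) : Prop :=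
  ∀ i, IsPrimitiveIdempotent Φ.Astar (θs i) (Φ.Estar i)

/-- The component `U i = (E*₀V + ⋯ + E*ᵢV) ∩ (E₀V + ⋯ + E_{d-i}V)` of the split decomposition. -/
def split (Φ : THSystemOn K V d) (i : Fin (d + 1)) : Submodule K V :=
  (⨆ h : Fin (d + 1), ⨆ _ : (h : ℕ) ≤ (i : ℕ), LinearMap.range (Φ.Estar h)) ⊓
    (⨆ h : Fin (d + 1), ⨆ _ : (h : ℕ) ≤ d - (i : ℕ), LinearMap.range (Φ.E h))

/-- Here `φ k` is the scalar usually written with index `k + 1`, so that `φ` lists the scalars with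
indices `1, …, d`. With `i = k + 1`, the component `U i` is nonzero and
`(A - θ_{d-i+1} I)(A* - θ*_i I)` acts on it as the scalar `φ k`; the index `d - i + 1 = d - k` is
written `Fin.rev k.castSucc`. -/
def IsSplitSeq (Φ : THSystemOn K V d) (θ θs : Fin (d + 1) → K) (φ : Fin d → K) : Prop :=
  ∀ k : Fin d, Φ.split k.succ ≠ ⊥ ∧ ∀ x ∈ Φ.split k.succ,
    ((Φ.A - θ (Fin.rev k.castSucc) • (1 : Module.End K V)) *
      (Φ.Astar - θs k.succ • (1 : Module.End K V))) x = φ k • x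

theorem Isomorphic.refl (Φ : THSystemOn K V d) : Isomorphic Φ Φ :=
  ⟨AlgEquiv.refl, rfl, rfl, fun _ => rfl, fun _ => rfl⟩

theorem Isomorphic.symm {Φ : THSystemOn K V d} {Ψ : THSystemOn K W d} (h : Isomorphic Φ Ψ) :
    Isomorphic Ψ Φ := by
  obtain ⟨γ, h1, h2, h3, h4⟩ := h
  exact ⟨γ.symm, by simp [h1], by simp [h2], fun i => by simp [h3], fun i => by simp [h4]⟩

theorem Isomorphic.trans {X : Type*} [AddCommGroup X] [Module K X] {Φ : THSystemOn K V d}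
    {Ψ : THSystemOn K W d} {Ω : THSystemOn K X d} (h : Isomorphic Φ Ψ) (h' : Isomorphic Ψ Ω) :
    Isomorphic Φ Ω := by
  obtain ⟨γ, h1, h2, h3, h4⟩ := h
  obtain ⟨δ, g1, g2, g3, g4⟩ := h'
  exact ⟨γ.trans δ, by simp [h1, g1], by simp [h2, g2], fun i => by simp [h3, g3],
    fun i => by simp [h4, g4]⟩

theorem AffineIsomorphic.refl (Φ : THSystemOn K V d) : AffineIsomorphic Φ Φ :=
  ⟨1, 0, 1, 0, one_ne_zero, one_ne_zero, AlgEquiv.refl, by simp [affine], by simp [affine],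
    fun _ => rfl, fun _ => rfl⟩

theorem AffineIsomorphic.symm {Φ : THSystemOn K V d} {Ψ : THSystemOn K W d}
    (h : AffineIsomorphic Φ Ψ) : AffineIsomorphic Ψ Φ := by
  obtain ⟨α, β, αs, βs, hα, hαs, γ, h1, h2, h3, h4⟩ := h
  simp only [affine] at h1 h2 h3 h4
  refine ⟨α⁻¹, -(α⁻¹ * β), αs⁻¹, -(αs⁻¹ * βs), inv_ne_zero hα, inv_ne_zero hαs, γ.symm, ?_, ?_,
    fun i => by simp [affine, h3], fun i => by simp [affine, h4]⟩
  · simp only [affine]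
    apply γ.injective
    simp [← h1, smul_smul, hα]
  · simp only [affine]
    apply γ.injective
    simp [← h2, smul_smul, hαs]

theorem AffineIsomorphic.trans {X : Type*} [AddCommGroup X] [Module K X] {Φ : THSystemOn K V d}
    {Ψ : THSystemOn K W d} {Ω : THSystemOn K X d} (h : AffineIsomorphic Φ Ψ)
    (h' : AffineIsomorphic Ψ Ω) : AffineIsomorphic Φ Ω := by
  obtain ⟨α, β, αs, βs, hα, hαs, γ, h1, h2, h3, h4⟩ := h
  obtain ⟨a, b, as, bs, ha, has, δ, g1, g2, g3, g4⟩ := h'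
  simp only [affine] at h1 h2 h3 h4 g1 g2 g3 g4
  refine ⟨α * a, α * b + β, αs * as, αs * bs + βs, mul_ne_zero hα ha, mul_ne_zero hαs has,
    γ.trans δ, ?_, ?_, fun i => by simp [affine, g3, h3], fun i => by simp [affine, g4, h4]⟩
  · simp [affine, ← h1, ← g1, mul_smul, add_smul, add_assoc]
  · simp [affine, ← h2, ← g2, mul_smul, add_smul, add_assoc]

end THSystemOn

/-- A TH system over `K` of diameter `d`, together with its underlying vector space. -/
structure THSystem (K : Type u) [Field K] (d : ℕ) where
  V : Type v
  [addCommGroup : AddCommGroup V]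
  [module : Module K V]
  sys : THSystemOn K V d

attribute [instance] THSystem.addCommGroup THSystem.module

/-- A parameter array over `K` of diameter `d`; the entry `φ k` carries the index `k + 1`. -/
@[ext]
structure ParameterArray (K : Type u) [Field K] (d : ℕ) where
  θ : Fin (d + 1) → K
  θs : Fin (d + 1) → K
  φ : Fin d → K
  θ_ne : ∀ i j, i ≠ j → θ i ≠ θ j
  θs_ne : ∀ i j, i ≠ j → θs i ≠ θs j
  φ_ne : ∀ k, φ k ≠ 0

/-- `p` is the parameter array of the TH system `Φ`. -/
def THSystem.IsParameterArrayOf {K : Type u} [Field K] {d : ℕ} (Φ : THSystem.{u, v} K d)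
    (p : ParameterArray K d) : Prop :=
  Φ.sys.IsEigenvalueSeq p.θ ∧ Φ.sys.IsDualEigenvalueSeq p.θs ∧ Φ.sys.IsSplitSeq p.θ p.θs p.φ

/-- Isomorphism of TH systems over `K` of diameter `d`. -/
def THSystem.isoSetoid (K : Type u) [Field K] (d : ℕ) : Setoid (THSystem.{u, v} K d) where
  r Φ Ψ := Φ.sys.Isomorphic Ψ.sys
  iseqv := ⟨fun Φ => .refl Φ.sys, fun h => h.symm, fun h h' => h.trans h'⟩

/-- Affine isomorphism of TH systems over `K` of diameter `d`. -/
def THSystem.affineSetoid (K : Type u) [Field K] (d : ℕ) : Setoid (THSystem.{u, v} K d) where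
  r Φ Ψ := Φ.sys.AffineIsomorphic Ψ.sys
  iseqv := ⟨fun Φ => .refl Φ.sys, fun h => h.symm, fun h h' => h.trans h'⟩

/-- The isomorphism classes of TH systems over `K` of diameter `d`. -/
abbrev IsoClass (K : Type u) [Field K] (d : ℕ) := Quotient (THSystem.isoSetoid.{u, v} K d)

/-- The affine isomorphism classes of TH systems over `K` of diameter `d`. -/
abbrev AffineIsoClass (K : Type u) [Field K] (d : ℕ) :=
  Quotient (THSystem.affineSetoid.{u, v} K d)

/-- The affine relation on parameter arrays. -/
def ParameterArray.AffineRelated {K : Type u} [Field K] {d : ℕ} (p p' : ParameterArray K d) :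
    Prop :=
  ∃ α β αs βs : K, α ≠ 0 ∧ αs ≠ 0 ∧ (∀ i, p'.θ i = α * p.θ i + β) ∧
    (∀ i, p'.θs i = αs * p.θs i + βs) ∧ ∀ k, p'.φ k = α * αs * p.φ k

/-- The affine relation is an equivalence relation. -/
def ParameterArray.affineSetoid (K : Type u) [Field K] (d : ℕ) :
    Setoid (ParameterArray K d) where
  r := ParameterArray.AffineRelated
  iseqv := by
    refine ⟨fun p => ⟨1, 0, 1, 0, one_ne_zero, one_ne_zero, by simp, by simp, by simp⟩, ?_, ?_⟩
    · rintro p q ⟨α, β, αs, βs, hα, hαs, h1, h2, h3⟩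
      refine ⟨α⁻¹, -(α⁻¹ * β), αs⁻¹, -(αs⁻¹ * βs), inv_ne_zero hα, inv_ne_zero hαs,
        fun i => ?_, fun i => ?_, fun k => ?_⟩
      · rw [h1]; field_simp; ring
      · rw [h2]; field_simp; ring
      · rw [h3]; field_simp
    · rintro p q r ⟨α, β, αs, βs, hα, hαs, h1, h2, h3⟩ ⟨a, b, as, bs, ha, has, g1, g2, g3⟩
      refine ⟨a * α, a * β + b, as * αs, as * βs + bs, mul_ne_zero ha hα, mul_ne_zero has hαs,
        fun i => ?_, fun i => ?_, fun k => ?_⟩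
      · rw [g1, h1]; ring
      · rw [g2, h2]; ring
      · rw [g3, h3]; ring

/-- The reduced parameter arrays over `K` of diameter `d`. -/
abbrev ReducedParameterArray (K : Type u) [Field K] (d : ℕ) :=
  Quotient (ParameterArray.affineSetoid K d)

end ThinHess

/-! The argument attaches to each TH system a split basis, in which `A` is lower bidiagonal with
diagonal `θ_d, …, θ_0` and subdiagonal `1`, while `A*` is upper bidiagonal with diagonal `θ*_0, …,
θ*_d` and superdiagonal `φ`. Start with an eigenvector of `A*` for `θ*_0` and apply `A - θ_d`, `A -
θ_{d-1}`, … in turn. The resulting vectors are adapted both to the flag of the `E*_i V` and, read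
backwards, to the flag of the `E_i V`, so the `i`-th one spans `U_i`. The Hessenberg conditions then
force the shape of `A*` and make every `φ_i` nonzero (`exists_flag_adapted_basis`,
`exists_isSplitBasis`).

A split basis is unique up to a common scalar, since its first vector lies in a one-dimensional
eigenspace and `A` generates the rest. Hence the parameter array is unique and can be read off from
any split basis. Every algebra isomorphism of endomorphism rings is a conjugation, and conjugation
carries split bases to split bases; conversely, matching two split bases with equal entries yields
an isomorphism (`isomorphic_iff`).

For surjectivity, write down the two bidiagonal matrices. Distinct diagonal entries give eigenbases
compatible with the flags, and nonzero off-diagonal entries give the Hessenberg conditions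
(`exists_thSystemOn`). The affine statement follows by rescaling the split basis. -/

namespace ThinHess

open Module

/-! ### Flags of initial spans of a basis. -/

section Flags

variable {K : Type u} [Field K] {V : Type v} [AddCommGroup V] [Module K V] {m : ℕ}

/-- The span of the first `n` vectors of a basis. -/
def flag (b : Basis (Fin m) K V) (n : ℕ) : Submodule K V :=
  Submodule.span K (b '' {i | (i : ℕ) < n})

theorem mem_flag {b : Basis (Fin m) K V} {n : ℕ} {x : V} :
    x ∈ flag b n ↔ ∀ i : Fin m, n ≤ i → b.repr x i = 0 := by
  rw [flag, Basis.mem_span_image]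
  constructor
  · intro h i hi
    by_contra hne
    exact absurd (h (Finsupp.mem_support_iff.2 hne)) (by simpa using hi)
  · intro h i hi
    by_contra hne
    exact (Finsupp.mem_support_iff.1 hi) (h i (by simpa using hne))

theorem basis_mem_flag (b : Basis (Fin m) K V) {n : ℕ} {i : Fin m} (h : (i : ℕ) < n) :
    b i ∈ flag b n :=
  Submodule.subset_span ⟨i, h, rfl⟩

theorem flag_le {b : Basis (Fin m) K V} {n : ℕ} {p : Submodule K V} :
    flag b n ≤ p ↔ ∀ i : Fin m, (i : ℕ) < n → b i ∈ p := by
  rw [flag, Submodule.span_le]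
  exact ⟨fun h i hi => h ⟨i, hi, rfl⟩, by rintro h _ ⟨i, hi, rfl⟩; exact h i hi⟩

theorem flag_mono (b : Basis (Fin m) K V) {n n' : ℕ} (h : n ≤ n') : flag b n ≤ flag b n' :=
  flag_le.2 fun _ hi => basis_mem_flag b (hi.trans_le h)

theorem flag_zero (b : Basis (Fin m) K V) : flag b 0 = ⊥ := by
  simp [flag]

theorem finrank_flag (b : Basis (Fin m) K V) (n : ℕ) :
    finrank K (flag b n) = Nat.card {i : Fin m // (i : ℕ) < n} := by
  have h : LinearIndependent K (fun i : {i : Fin m // (i : ℕ) < n} => b i) :=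
    b.linearIndependent.comp _ Subtype.val_injective
  rw [Nat.card_eq_fintype_card, ← finrank_span_eq_card h, flag]
  rw [Set.image_eq_range]
  rfl

/-- Triangularity gives one inclusion, and the two spaces have the same dimension. -/
theorem flag_eq_flag {b c : Basis (Fin m) K V} (h : ∀ i : Fin m, c i ∈ flag b (i + 1)) (n : ℕ) :
    flag c n = flag b n := by
  have : FiniteDimensional K V := b.finiteDimensional_of_finite
  refine Submodule.eq_of_le_of_finrank_eq (flag_le.2 fun i hi => ?_)
    (by rw [finrank_flag, finrank_flag])
  exact flag_mono b hi (h i)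

theorem mem_flag_succ_of_repr_eq_zero {b : Basis (Fin m) K V} {i : Fin m} {x : V}
    (hx : x ∈ flag b (i + 1)) (h0 : b.repr x i = 0) : x ∈ flag b i := by
  rw [mem_flag] at hx ⊢
  intro j hj
  rcases hj.eq_or_lt with e | hj
  · rwa [← Fin.ext e]
  · exact hx j hj

/-- If this leading coefficient vanished, `c i` would already lie in the span of the earlier vectors
of `c`. -/
theorem repr_ne_zero_of_flag_eq {b c : Basis (Fin m) K V} (h : ∀ n, flag c n = flag b n)
    (i : Fin m) : b.repr (c i) i ≠ 0 := by
  intro h0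
  have h1 : c i ∈ flag b i := mem_flag_succ_of_repr_eq_zero
    (by rw [← h]; exact basis_mem_flag c (Nat.lt_succ_self _)) h0
  rw [← h, mem_flag] at h1
  simpa using h1 i le_rfl

theorem exists_basis_of_triangular (w : Basis (Fin m) K V) (x : Fin m → V)
    (h1 : ∀ i : Fin m, x i ∈ flag w (i + 1)) (h2 : ∀ i, w.repr (x i) i ≠ 0) :
    ∃ b : Basis (Fin m) K V, ⇑b = x := by
  have hT : (w.toMatrix x).BlockTriangular id := fun i j hij => by
    rw [Basis.toMatrix_apply]
    exact mem_flag.1 (h1 j) i hij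
  have hdet : IsUnit (w.det x) := by
    rw [Basis.det_apply, Matrix.det_of_isUpperTriangular hT, isUnit_iff_ne_zero,
      Finset.prod_ne_zero_iff]
    exact fun i _ => h2 i
  obtain ⟨hli, hspan⟩ := w.is_basis_iff_det.2 hdet
  exact ⟨Basis.mk hli hspan.ge, Basis.coe_mk _ _⟩

end Flags

/-! ### Bidiagonal operators, their flags and eigenvectors. -/

section Bidiagonal

variable {K : Type u} [Field K] {V : Type v} [AddCommGroup V] [Module K V] {d : ℕ}

/-- `T` is represented in the basis `b` by the lower bidiagonal matrix with diagonal `t` and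
subdiagonal `n`. -/
structure IsLowerBidiagonal (T : End K V) (b : Basis (Fin (d + 1)) K V) (t : Fin (d + 1) → K)
    (n : Fin d → K) : Prop where
  castSucc : ∀ k : Fin d, T (b k.castSucc) = t k.castSucc • b k.castSucc + n k • b k.succ
  last : T (b (Fin.last d)) = t (Fin.last d) • b (Fin.last d)

/-- `T` is represented in the basis `b` by the upper bidiagonal matrix with diagonal `t` and
superdiagonal `n`. -/
structure IsUpperBidiagonal (T : End K V) (b : Basis (Fin (d + 1)) K V) (t : Fin (d + 1) → K)
    (n : Fin d → K) : Prop where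
  zero : T (b 0) = t 0 • b 0
  succ : ∀ k : Fin d, T (b k.succ) = t k.succ • b k.succ + n k • b k.castSucc

variable {T : End K V} {b : Basis (Fin (d + 1)) K V} {t : Fin (d + 1) → K} {n : Fin d → K}

/-- Reversing the basis exchanges the two shapes, so each fact below is needed for one shape only.
-/
theorem IsLowerBidiagonal.rev (h : IsLowerBidiagonal T b t n) :
    IsUpperBidiagonal T (b.reindex Fin.revPerm) (t ∘ Fin.rev) (n ∘ Fin.rev) where
  zero := by simpa using h.last
  succ k := by simpa [Fin.rev_succ, Fin.rev_castSucc] using h.castSucc k.rev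

theorem IsUpperBidiagonal.rev (h : IsUpperBidiagonal T b t n) :
    IsLowerBidiagonal T (b.reindex Fin.revPerm) (t ∘ Fin.rev) (n ∘ Fin.rev) where
  last := by simpa using h.zero
  castSucc k := by simpa [Fin.rev_succ, Fin.rev_castSucc] using h.succ k.rev

theorem IsLowerBidiagonal.repr_succ (h : IsLowerBidiagonal T b t n) (x : V) (k : Fin d) :
    b.repr (T x) k.succ = t k.succ * b.repr x k.succ + n k * b.repr x k.castSucc := by
  have e : b.coord k.succ ∘ₗ T = t k.succ • b.coord k.succ + n k • b.coord k.castSucc := by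
    refine b.ext fun i => ?_
    induction i using Fin.lastCases with
    | last =>
      -- Either the indices agree and so do the diagonal entries, or the coordinate is zero.
      have h2 : t (Fin.last d) = t k.succ ∨ Fin.last d ≠ k.succ :=
        or_iff_not_imp_right.2 fun h => by rw [not_not.1 h]
      rcases h2 with h2 | h2 <;> simp [h.last, Finsupp.single_apply, h2]
    | cast i =>
      by_cases hik : i = k
      · subst hik
        have h1 : i.castSucc ≠ i.succ := (Fin.castSucc_lt_succ).ne
        simp [h.castSucc, h1]
      · have h2 : t i.castSucc = t k.succ ∨ i.castSucc ≠ k.succ :=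
          or_iff_not_imp_right.2 fun h => by rw [not_not.1 h]
        rcases h2 with h2 | h2 <;> simp [h.castSucc, Finsupp.single_apply, hik, h2]
  simpa using LinearMap.congr_fun e x

theorem IsLowerBidiagonal.map_flag (h : IsLowerBidiagonal T b t n) {j : ℕ} {x : V}
    (hx : x ∈ flag b j) : T x ∈ flag b (j + 1) := by
  refine (flag_le (p := (flag b (j + 1)).comap T)).2 (fun i hi => ?_) hx
  rw [Submodule.mem_comap]
  induction i using Fin.lastCases with
  | last =>
    rw [h.last]
    exact Submodule.smul_mem _ _ (basis_mem_flag b (hi.trans (Nat.lt_succ_self _)))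
  | cast i =>
    rw [h.castSucc]
    exact add_mem (Submodule.smul_mem _ _ (basis_mem_flag b (hi.trans (Nat.lt_succ_self _))))
      (Submodule.smul_mem _ _ (basis_mem_flag b (by simpa using hi)))

/-- In a basis inducing the same flag as `b`, a lower bidiagonal operator is Hessenberg, and its
subdiagonal entries vanish exactly where those of the bidiagonal matrix do. -/
theorem IsLowerBidiagonal.repr_eq_zero (h : IsLowerBidiagonal T b t n)
    {c : Basis (Fin (d + 1)) K V} (hc : ∀ j, flag c j = flag b j) {i j : Fin (d + 1)}
    (hij : (j : ℕ) + 1 < i) : c.repr (T (c j)) i = 0 := by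
  have h1 : T (c j) ∈ flag b (j + 1 + 1) :=
    h.map_flag (by rw [← hc]; exact basis_mem_flag c (Nat.lt_succ_self _))
  rw [← hc, mem_flag] at h1
  exact h1 i hij

/-- Vanishing of the entry means that `T (c k.castSucc)` stays in `flag b (k + 1)`, a condition on
the flag alone. Computed in `b`, the entry is `n k` times the nonzero leading coefficient of `c
k.castSucc`. -/
theorem IsLowerBidiagonal.repr_subdiag (h : IsLowerBidiagonal T b t n)
    {c : Basis (Fin (d + 1)) K V} (hc : ∀ j, flag c j = flag b j) (k : Fin d) :
    c.repr (T (c k.castSucc)) k.succ = 0 ↔ n k = 0 := by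
  have hm : c k.castSucc ∈ flag b (k + 1) := by
    rw [← hc]; exact basis_mem_flag c (Nat.lt_succ_self _)
  have hT := h.map_flag hm
  have h1 : b.repr (T (c k.castSucc)) k.succ = n k * b.repr (c k.castSucc) k.castSucc := by
    rw [h.repr_succ, mem_flag.1 hm k.succ (by simp), mul_zero, zero_add]
  have h2 : c.repr (T (c k.castSucc)) k.succ = 0 ↔ b.repr (T (c k.castSucc)) k.succ = 0 := by
    have key : ∀ e : Basis (Fin (d + 1)) K V, (∀ j, flag e j = flag b j) →
        (e.repr (T (c k.castSucc)) k.succ = 0 ↔ T (c k.castSucc) ∈ flag b (k + 1)) := by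
      intro e he
      rw [← he] at hT ⊢
      exact ⟨fun h0 => mem_flag_succ_of_repr_eq_zero (i := k.succ) (by simpa using hT) h0,
        fun h0 => mem_flag.1 h0 k.succ (by simp)⟩
    rw [key c hc, key b fun _ => rfl]
  rw [h2, h1, mul_eq_zero, or_iff_left (repr_ne_zero_of_flag_eq hc _)]

theorem IsUpperBidiagonal.sub_smul_mem_flag (h : IsUpperBidiagonal T b t n) (i : Fin (d + 1))
    {x : V} (hx : x ∈ flag b (i + 1)) : (T - t i • (1 : End K V)) x ∈ flag b i := by
  refine (flag_le (p := (flag b i).comap (T - t i • (1 : End K V)))).2 (fun j hj => ?_) hx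
  have hT : T (b j) - t j • b j ∈ flag b i := by
    induction j using Fin.cases with
    | zero => simp [h.zero]
    | succ k =>
      rw [h.succ, add_sub_cancel_left]
      refine Submodule.smul_mem _ _ (basis_mem_flag b ?_)
      simp at hj ⊢
      omega
  have e : (T - t i • (1 : End K V)) (b j) = (T (b j) - t j • b j) + (t j - t i) • b j := by
    simp [sub_smul]
  rw [Submodule.mem_comap, e]
  refine add_mem hT ?_
  rcases (Nat.lt_succ_iff.1 hj).eq_or_lt with hji | hji
  · simp [Fin.ext hji]
  · exact Submodule.smul_mem _ _ (basis_mem_flag b hji)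

/-- `T - t i` maps `flag b (i + 1)` into the smaller `flag b i`, so it has a kernel there.
Distinctness of the `t i` makes these eigenvectors independent. -/
theorem IsUpperBidiagonal.exists_eigenbasis (h : IsUpperBidiagonal T b t n)
    (ht : Function.Injective t) :
    ∃ v : Basis (Fin (d + 1)) K V, (∀ i, T (v i) = t i • v i) ∧ ∀ j, flag v j = flag b j := by
  have : FiniteDimensional K V := b.finiteDimensional_of_finite
  have hex : ∀ i : Fin (d + 1), ∃ x ∈ flag b (i + 1), T x = t i • x ∧ x ≠ 0 := by
    intro i
    let f := (T - t i • (1 : End K V)).restrict (p := flag b (i + 1)) (q := flag b i)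
      fun x hx => h.sub_smul_mem_flag i hx
    have hlt : finrank K (flag b i) < finrank K (flag b (i + 1)) := by
      refine Submodule.finrank_lt_finrank_of_lt (lt_of_le_of_ne (flag_mono b (Nat.le_succ _)) ?_)
      intro e
      have h1 : b i ∈ flag b i := by
        rw [e]; exact basis_mem_flag b (Nat.lt_succ_self _)
      simpa using mem_flag.1 h1 i le_rfl
    obtain ⟨x, hx, hx0⟩ := Submodule.exists_mem_ne_zero_of_ne_bot
      (LinearMap.ker_ne_bot_of_finrank_lt (f := f) hlt)
    refine ⟨x, x.2, ?_, by simpa using hx0⟩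
    have := congrArg Subtype.val (LinearMap.mem_ker.1 hx)
    simpa [f, LinearMap.restrict_apply, sub_eq_zero] using this
  choose x hx hTx hx0 using hex
  have hli := End.eigenvectors_linearIndependent' T t ht x fun i =>
    ⟨End.mem_eigenspace_iff.2 (hTx i), hx0 i⟩
  let v := basisOfLinearIndependentOfCardEqFinrank hli (finrank_eq_card_basis b).symm
  have hv : ⇑v = x := coe_basisOfLinearIndependentOfCardEqFinrank _ _
  exact ⟨v, fun i => by rw [hv]; exact hTx i, flag_eq_flag fun i => by rw [hv]; exact hx i⟩

end Bidiagonal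

/-! ### Eigenbases and the Hessenberg condition in coordinates. -/

section Eigenbasis

variable {K : Type u} [Field K] {V : Type v} [AddCommGroup V] [Module K V] {d : ℕ}

/-- `v` consists of eigenvectors of `A` for the distinct eigenvalues `θ i`, and the `E i` are the
projections onto the lines spanned by the vectors of `v`. -/
structure IsEigenbasis (A : End K V) (E : Fin (d + 1) → End K V) (θ : Fin (d + 1) → K)
    (v : Basis (Fin (d + 1)) K V) : Prop where
  injective : Function.Injective θ
  map_apply : ∀ i, A (v i) = θ i • v i
  proj_apply : ∀ i x, E i x = v.repr x i • v i

variable {A B : End K V} {E : Fin (d + 1) → End K V} {θ : Fin (d + 1) → K}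
  {v : Basis (Fin (d + 1)) K V}

theorem IsPrimitiveIdempotent.eigenvalue_unique {F : End K V} {μ ν : K}
    (h : IsPrimitiveIdempotent A μ F) (h' : IsPrimitiveIdempotent A ν F) : μ = ν := by
  by_contra hne
  obtain ⟨x, hx, hx0⟩ := h.1.exists_hasEigenvector
  exact hx0 (by rw [← h.2.1 x hx, h'.2.2 μ hne x hx])

theorem IsIdempotentOrdering.exists_eigenvalues (h : IsIdempotentOrdering A E) :
    ∃ θ : Fin (d + 1) → K, ∀ i, IsPrimitiveIdempotent A (θ i) (E i) := by
  have hE : ∀ i, ∃ θ : K, IsPrimitiveIdempotent A θ (E i) := fun i => by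
    have : E i ∈ Set.range E := ⟨i, rfl⟩
    rwa [h.2] at this
  exact ⟨fun i => (hE i).choose, fun i => (hE i).choose_spec⟩

theorem IsIdempotentOrdering.exists_eigenbasis (h : IsIdempotentOrdering A E)
    (hA : IsMultiplicityFree A) (hd : finrank K V = d + 1)
    (hθ : ∀ i, IsPrimitiveIdempotent A (θ i) (E i)) :
    ∃ v : Basis (Fin (d + 1)) K V, IsEigenbasis A E θ v := by
  -- With a common eigenvalue, `E i` and `E j` would fix the same eigenvector, contradicting `E i *
  -- E j = 0`.
  have hinj : Function.Injective θ := by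
    intro i j hij
    by_contra hne
    obtain ⟨x, hx, hx0⟩ := (hθ i).1.exists_hasEigenvector
    have h1 := LinearMap.congr_fun (h.mul_eq_zero hA hne) x
    rw [End.mul_apply, (hθ j).2.1 x (hij ▸ hx), (hθ i).2.1 x hx] at h1
    exact hx0 h1
  choose x hx using fun i => (hθ i).1.exists_hasEigenvector
  have hli := End.eigenvectors_linearIndependent' A θ hinj x hx
  let v := basisOfLinearIndependentOfCardEqFinrank hli (by simp [hd])
  have hv : ⇑v = x := coe_basisOfLinearIndependentOfCardEqFinrank _ _
  refine ⟨v, hinj, fun i => by rw [hv]; exact (hx i).apply_eq_smul, fun i y => ?_⟩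
  have e : E i = (v.coord i).smulRight (v i) := by
    refine v.ext fun j => ?_
    rw [hv]
    by_cases hij : j = i
    · subst hij
      rw [(hθ j).2.1 _ (hx j).1]
      simp [← hv]
    · rw [(hθ i).2.2 (θ j) (fun e => hij (hinj e)) _ (hx j).1]
      simp [← hv, hij]
  rw [e]
  simp

namespace IsEigenbasis

theorem proj_apply_self (h : IsEigenbasis A E θ v) (i : Fin (d + 1)) : E i (v i) = v i := by
  simp [h.proj_apply]

theorem proj_apply_of_ne (h : IsEigenbasis A E θ v) {i j : Fin (d + 1)} (hij : j ≠ i) :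
    E i (v j) = 0 := by
  simp [h.proj_apply, hij]

theorem repr_map (h : IsEigenbasis A E θ v) (x : V) (i : Fin (d + 1)) :
    v.repr (A x) i = θ i * v.repr x i := by
  have e : v.coord i ∘ₗ A = θ i • v.coord i := by
    refine v.ext fun j => ?_
    by_cases hij : j = i
    · subst hij
      simp [h.map_apply]
    · simp [h.map_apply, hij]
  simpa using LinearMap.congr_fun e x

theorem mem_eigenspace (h : IsEigenbasis A E θ v) {x : V} {μ : K} :
    x ∈ A.eigenspace μ ↔ ∀ i, θ i ≠ μ → v.repr x i = 0 := by
  rw [End.mem_eigenspace_iff, ← v.repr.injective.eq_iff, Finsupp.ext_iff]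
  refine forall_congr' fun i => ?_
  rw [h.repr_map, map_smul, Finsupp.smul_apply, smul_eq_mul, ← sub_eq_zero, ← sub_mul,
    mul_eq_zero, sub_eq_zero, or_iff_not_imp_left]

theorem eigenspace_eq (h : IsEigenbasis A E θ v) (i : Fin (d + 1)) :
    A.eigenspace (θ i) = Submodule.span K {v i} := by
  ext x
  rw [h.mem_eigenspace, ← Set.image_singleton, Basis.mem_span_image]
  constructor
  · intro hx j hj
    by_contra hne
    exact Finsupp.mem_support_iff.1 hj (hx j fun e => hne (h.injective e))
  · intro hx j hj
    by_contra hne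
    exact hj (congrArg θ (hx (Finsupp.mem_support_iff.2 hne)))

theorem eq_of_hasEigenvalue (h : IsEigenbasis A E θ v) {μ : K} (hμ : A.HasEigenvalue μ) :
    ∃ i, θ i = μ := by
  obtain ⟨x, hx, hx0⟩ := hμ.exists_hasEigenvector
  by_contra! hne
  exact hx0 (v.ext_elem fun i => by rw [h.mem_eigenspace.1 hx i (hne i)]; simp)

theorem isMultiplicityFree (h : IsEigenbasis A E θ v) : IsMultiplicityFree A := by
  constructor
  · rw [eq_top_iff, ← v.span_eq, Submodule.span_le]
    rintro _ ⟨i, rfl⟩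
    exact Submodule.mem_iSup_of_mem (θ i) (End.mem_eigenspace_iff.2 (h.map_apply i))
  · intro μ hμ
    obtain ⟨i, rfl⟩ := h.eq_of_hasEigenvalue hμ
    rw [h.eigenspace_eq, finrank_span_singleton (v.ne_zero i)]

theorem isPrimitiveIdempotent (h : IsEigenbasis A E θ v) (i : Fin (d + 1)) :
    IsPrimitiveIdempotent A (θ i) (E i) := by
  refine ⟨End.hasEigenvalue_of_hasEigenvector
    ⟨End.mem_eigenspace_iff.2 (h.map_apply i), v.ne_zero i⟩, fun x hx => ?_, fun μ hμ x hx => ?_⟩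
  · rw [h.eigenspace_eq] at hx
    obtain ⟨c, rfl⟩ := Submodule.mem_span_singleton.1 hx
    rw [map_smul, h.proj_apply_self]
  · rw [h.proj_apply, h.mem_eigenspace.1 hx i hμ.symm, zero_smul]

theorem isIdempotentOrdering (h : IsEigenbasis A E θ v) : IsIdempotentOrdering A E := by
  constructor
  · intro i j hij
    by_contra hne
    have h1 := h.proj_apply_self i
    rw [hij, h.proj_apply_of_ne hne] at h1
    exact v.ne_zero i h1.symm
  · ext F
    constructor
    · rintro ⟨i, rfl⟩
      exact ⟨θ i, h.isPrimitiveIdempotent i⟩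
    · rintro ⟨μ, hF⟩
      obtain ⟨i, rfl⟩ := h.eq_of_hasEigenvalue hF.1
      refine ⟨i, v.ext fun j => ?_⟩
      have hj : v j ∈ A.eigenspace (θ j) := End.mem_eigenspace_iff.2 (h.map_apply j)
      by_cases hij : j = i
      · subst hij
        rw [h.proj_apply_self, hF.2.1 _ hj]
      · rw [h.proj_apply_of_ne hij, hF.2.2 _ (h.injective.ne hij) _ hj]

/-- `E i * B * E j` retains only the `(i, j)` entry of the matrix of `B` in `v`. -/
theorem proj_mul_mul_proj_eq_zero (h : IsEigenbasis A E θ v) (i j : Fin (d + 1)) :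
    E i * B * E j = 0 ↔ v.repr (B (v j)) i = 0 := by
  constructor
  · intro h0
    have h1 := LinearMap.congr_fun h0 (v j)
    rw [End.mul_apply, End.mul_apply, h.proj_apply_self, h.proj_apply] at h1
    exact (smul_eq_zero.1 h1).resolve_right (v.ne_zero i)
  · intro h0
    refine LinearMap.ext fun x => ?_
    rw [End.mul_apply, End.mul_apply, h.proj_apply j, map_smul, map_smul, h.proj_apply, h0]
    simp

theorem range_proj (h : IsEigenbasis A E θ v) (i : Fin (d + 1)) :
    LinearMap.range (E i) = Submodule.span K {v i} := by
  apply le_antisymm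
  · rintro _ ⟨x, rfl⟩
    rw [h.proj_apply]
    exact Submodule.smul_mem _ _ (Submodule.mem_span_singleton_self _)
  · rw [Submodule.span_singleton_le_iff_mem]
    exact ⟨v i, h.proj_apply_self i⟩

theorem iSup_range_proj (h : IsEigenbasis A E θ v) (n : ℕ) :
    (⨆ i : Fin (d + 1), ⨆ _ : (i : ℕ) ≤ n, LinearMap.range (E i)) = flag v (n + 1) := by
  apply le_antisymm
  · refine iSup₂_le fun i hi => ?_
    rw [h.range_proj, Submodule.span_singleton_le_iff_mem]
    exact basis_mem_flag v (Nat.lt_succ_of_le hi)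
  · refine flag_le.2 fun i hi => ?_
    exact Submodule.mem_iSup_of_mem i (Submodule.mem_iSup_of_mem (Nat.le_of_lt_succ hi)
      ⟨v i, h.proj_apply_self i⟩)

theorem isUpperBidiagonal (h : IsEigenbasis A E θ v) : IsUpperBidiagonal A v θ 0 where
  zero := h.map_apply 0
  succ k := by simp [h.map_apply]

theorem map_flag (h : IsEigenbasis A E θ v) (hB : IsHessenbergFor E B) {n : ℕ} {x : V}
    (hx : x ∈ flag v n) : B x ∈ flag v (n + 1) := by
  refine (flag_le (p := (flag v (n + 1)).comap B)).2 (fun j hj => ?_) hx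
  rw [Submodule.mem_comap, mem_flag]
  intro i hi
  exact (h.proj_mul_mul_proj_eq_zero i j).1 ((hB i j).1 (by omega))

theorem repr_subdiag_ne_zero (h : IsEigenbasis A E θ v) (hB : IsHessenbergFor E B) (k : Fin d) :
    v.repr (B (v k.castSucc)) k.succ ≠ 0 :=
  (h.proj_mul_mul_proj_eq_zero _ _).not.1 ((hB k.succ k.castSucc).2 (by simp))

/-- Only the top term of `x` contributes: `B` sends the remainder, in `flag v k`, into `flag v (k +
1)`. -/
theorem repr_succ_ne_zero (h : IsEigenbasis A E θ v) (hB : IsHessenbergFor E B) (k : Fin d)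
    {x : V} (hx : x ∈ flag v (k + 1)) (h0 : v.repr x k.castSucc ≠ 0) :
    v.repr (B x) k.succ ≠ 0 := by
  have h1 : x - v.repr x k.castSucc • v k.castSucc ∈ flag v k := by
    refine mem_flag_succ_of_repr_eq_zero (i := k.castSucc) ?_ (by simp)
    exact sub_mem hx (Submodule.smul_mem _ _ (basis_mem_flag v (Nat.lt_succ_self _)))
  have h2 := mem_flag.1 (h.map_flag hB h1) k.succ (by simp)
  rw [map_sub, map_sub, Finsupp.sub_apply, sub_eq_zero] at h2
  rw [h2, map_smul, map_smul, Finsupp.smul_apply, smul_eq_mul]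
  exact mul_ne_zero h0 (h.repr_subdiag_ne_zero hB k)

end IsEigenbasis

/-- The projections onto the lines spanned by the vectors of a basis. -/
noncomputable def basisProj (v : Basis (Fin (d + 1)) K V) (i : Fin (d + 1)) : End K V :=
  (v.coord i).smulRight (v i)

theorem isEigenbasis_basisProj (hθ : Function.Injective θ) (hv : ∀ i, A (v i) = θ i • v i) :
    IsEigenbasis A (basisProj v) θ v :=
  ⟨hθ, hv, fun i x => by simp [basisProj]⟩

theorem IsLowerBidiagonal.isHessenbergFor {b : Basis (Fin (d + 1)) K V} {t : Fin (d + 1) → K}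
    {n : Fin d → K} (hB : IsLowerBidiagonal B b t n) (hn : ∀ k, n k ≠ 0)
    (h : IsEigenbasis A E θ v) (hv : ∀ j, flag v j = flag b j) : IsHessenbergFor E B := by
  intro i j
  rw [Ne, h.proj_mul_mul_proj_eq_zero]
  refine ⟨fun hij => hB.repr_eq_zero hv hij, fun hij => ?_⟩
  have hj : (j : ℕ) < d := by omega
  obtain ⟨k, rfl⟩ : ∃ k : Fin d, j = k.castSucc := ⟨⟨j, hj⟩, rfl⟩
  obtain rfl : i = k.succ := Fin.ext (by simpa using hij)
  rw [hB.repr_subdiag hv]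
  exact hn k

end Eigenbasis

/-! ### Existence and uniqueness of split bases. -/

section SplitBasis

variable {K : Type u} [Field K] {V : Type v} [AddCommGroup V] [Module K V] {d : ℕ}

/-- The two flag members are spanned by `b 0, …, b i` and by `b i, …, b d`. -/
theorem flag_inf_flag_reindex_rev (b : Basis (Fin (d + 1)) K V) (i : Fin (d + 1)) :
    flag b (i + 1) ⊓ flag (b.reindex Fin.revPerm) (d - i + 1) = Submodule.span K {b i} := by
  ext x
  rw [Submodule.mem_inf, mem_flag, mem_flag, ← Set.image_singleton, Basis.mem_span_image]
  constructor
  · rintro ⟨h1, h2⟩ j hj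
    by_contra hne
    apply Finsupp.mem_support_iff.1 hj
    rcases lt_or_gt_of_ne (fun e => hne (Fin.ext e) : (j : ℕ) ≠ i) with hlt | hgt
    · have := h2 j.rev (by rw [Fin.val_rev]; omega)
      simpa using this
    · exact h1 j hgt
  · intro h
    have h0 : ∀ j, j ≠ i → b.repr x j = 0 := fun j hj => by
      by_contra hne
      exact hj (h (Finsupp.mem_support_iff.2 hne))
    refine ⟨fun j hj => h0 j ?_, fun j hj => ?_⟩
    · rintro rfl
      omega
    · have : j.rev ≠ i := by
        rintro rfl
        rw [Fin.val_rev] at hj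
        omega
      simpa using h0 _ this

/-- In the split basis `b`, the operators `A` and `B` are lower and upper bidiagonal, respectively,
with the entries prescribed by a parameter array. -/
structure IsSplitBasis (A B : End K V) (θ θs : Fin (d + 1) → K) (φ : Fin d → K)
    (b : Basis (Fin (d + 1)) K V) : Prop where
  lower : IsLowerBidiagonal A b (θ ∘ Fin.rev) 1
  upper : IsUpperBidiagonal B b θs φ

variable {A B : End K V} {E Es : Fin (d + 1) → End K V} {θ θs : Fin (d + 1) → K}
  {v w : Basis (Fin (d + 1)) K V}

/-- Each factor `A - θ_{d-i}` raises the level in the flag of `w` by exactly one, because `A` is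
Hessenberg there, and lowers the level in the flag of `v` by one, because it kills the top
eigenvector. -/
theorem exists_flag_adapted_basis (hv : IsEigenbasis A E θ v) (hw : IsEigenbasis B Es θs w)
    (hEs : IsHessenbergFor Es A) :
    ∃ b : Basis (Fin (d + 1)) K V, IsLowerBidiagonal A b (θ ∘ Fin.rev) 1 ∧
      (∀ n, flag b n = flag w n) ∧ ∀ n, flag (b.reindex Fin.revPerm) n = flag v n := by
  -- Indexing by `ℕ` makes `u (d + 1)` available; the wraparound of `Fin.ofNat` never matters, since
  -- only `n ≤ d` is used in the recursion.
  let u : ℕ → V := fun n => Nat.rec (w 0)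
    (fun n x => (A - θ (Fin.rev (Fin.ofNat (d + 1) n)) • (1 : End K V)) x) n
  have hu : ∀ i : Fin (d + 1), u (i + 1) = (A - θ i.rev • (1 : End K V)) (u i) := fun i => by
    change (A - θ (Fin.rev (Fin.ofNat (d + 1) i)) • (1 : End K V)) (u i) = _
    rw [Fin.ofNat_eq_cast, Fin.cast_val_eq_self]
  have huw : ∀ i : Fin (d + 1), u i ∈ flag w (i + 1) ∧ w.repr (u i) i ≠ 0 := by
    intro i
    induction i using Fin.induction with
    | zero =>
      refine ⟨basis_mem_flag w (Nat.lt_succ_self 0), ?_⟩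
      change w.repr (w 0) 0 ≠ 0
      simp
    | succ k ih =>
      have hk := hu k.castSucc
      rw [Fin.val_castSucc] at hk ih
      rw [Fin.val_succ, hk]
      have e : (A - θ k.castSucc.rev • (1 : End K V)) (u k) = A (u k) - θ k.castSucc.rev • u k := by
        simp
      rw [e]
      refine ⟨sub_mem (hw.map_flag hEs ih.1)
        (Submodule.smul_mem _ _ (flag_mono w (Nat.le_succ _) ih.1)), ?_⟩
      rw [map_sub, Finsupp.sub_apply, map_smul, Finsupp.smul_apply,
        mem_flag.1 ih.1 k.succ (by simp), smul_zero, sub_zero]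
      exact hw.repr_succ_ne_zero hEs k ih.1 ih.2
  have huv : ∀ n, n ≤ d + 1 → u n ∈ flag v (d + 1 - n) := by
    intro n
    induction n with
    | zero =>
      intro _
      rw [mem_flag]
      intro i hi
      omega
    | succ n ih =>
      intro hn
      have h1 := hu ⟨n, hn⟩
      simp only at h1
      rw [h1]
      have h2 := hv.isUpperBidiagonal.sub_smul_mem_flag (Fin.rev ⟨n, hn⟩) (x := u n) (by
        have := ih (by omega)
        rw [Fin.val_rev]
        convert this using 2
        simp only
        omega)
      rw [Fin.val_rev] at h2
      exact h2
  obtain ⟨b, hb⟩ := exists_basis_of_triangular w (fun i => u i) (fun i => (huw i).1)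
    fun i => (huw i).2
  have hbu : ∀ i, b i = u i := fun i => congrFun hb i
  refine ⟨b, ⟨fun k => ?_, ?_⟩, flag_eq_flag fun i => by rw [hbu]; exact (huw i).1,
    flag_eq_flag fun i => ?_⟩
  · have h1 := hu k.castSucc
    rw [hbu, hbu, Fin.val_succ, Pi.one_apply, one_smul, Function.comp_apply]
    rw [Fin.val_castSucc] at h1 ⊢
    rw [h1]
    simp
  -- `u (d + 1)` lies in `flag v 0 = ⊥`, so `u d` is an eigenvector of `A` for `θ 0`.
  · have h1 := hu (Fin.last d)
    have h2 := huv (d + 1) le_rfl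
    rw [Nat.sub_self, flag_zero, Submodule.mem_bot] at h2
    rw [Fin.val_last, h2] at h1
    rw [hbu, Fin.val_last, Function.comp_apply]
    have h3 : A (u d) - θ 0 • u d = 0 := by simpa using h1.symm
    simpa using sub_eq_zero.1 h3
  · have h1 := huv i.rev (by omega)
    rw [Basis.reindex_apply, Fin.revPerm_symm, Fin.revPerm_apply, hbu]
    rw [Fin.val_rev] at h1 ⊢
    convert h1 using 2
    omega

/-- `B - θs i` lowers the level in the flag of `w` and raises the level in the flag of `v` by at
most one, so it sends the line `U i` into the line `U (i - 1)`. -/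
theorem exists_isSplitBasis (hv : IsEigenbasis A E θ v) (hw : IsEigenbasis B Es θs w)
    (hE : IsHessenbergFor E B) (hEs : IsHessenbergFor Es A) :
    ∃ (φ : Fin d → K) (b : Basis (Fin (d + 1)) K V), (∀ k, φ k ≠ 0) ∧
      IsSplitBasis A B θ θs φ b ∧
      ∀ i : Fin (d + 1), flag w (i + 1) ⊓ flag v (d - i + 1) = Submodule.span K {b i} := by
  obtain ⟨b, hA, hbw, hbv⟩ := exists_flag_adapted_basis hv hw hEs
  have hsp : ∀ i : Fin (d + 1),
      flag w (i + 1) ⊓ flag v (d - i + 1) = Submodule.span K {b i} := fun i => by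
    rw [← hbw, ← hbv, flag_inf_flag_reindex_rev]
  have hmem : ∀ i : Fin (d + 1), b i ∈ flag w (i + 1) ⊓ flag v (d - i + 1) := fun i => by
    rw [hsp]; exact Submodule.mem_span_singleton_self _
  have hsub : ∀ i : Fin (d + 1), B (b i) - θs i • b i ∈ flag w i := fun i => by
    simpa using hw.isUpperBidiagonal.sub_smul_mem_flag i (hmem i).1
  have hex : ∀ k : Fin d, ∃ c : K, c • b k.castSucc = B (b k.succ) - θs k.succ • b k.succ := by
    intro k
    rw [← Submodule.mem_span_singleton, ← hsp]
    refine ⟨hsub k.succ, ?_⟩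
    have h1 := (hmem k.succ).2
    have h2 := hv.map_flag hE h1
    have e : d - (k.succ : ℕ) + 1 + 1 = d - (k.castSucc : ℕ) + 1 := by
      rw [Fin.val_succ, Fin.val_castSucc]; omega
    rw [← e]
    exact sub_mem h2 (Submodule.smul_mem _ _ (flag_mono v (Nat.le_succ _) h1))
  choose φ hφ using hex
  have hB : IsUpperBidiagonal B b θs φ := by
    refine ⟨?_, fun k => by rw [hφ]; abel⟩
    have h1 := hsub 0
    rw [Fin.val_zero, flag_zero, Submodule.mem_bot, sub_eq_zero] at h1
    exact h1
  refine ⟨φ, b, fun k => ?_, ⟨hA, hB⟩, hsp⟩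
  -- In the reversed split basis `B` is lower bidiagonal with subdiagonal `φ ∘ Fin.rev`. Its flag is
  -- that of `v`, where the subdiagonal of `B` never vanishes.
  have h1 := hv.repr_subdiag_ne_zero hE k.rev
  rw [Ne, hB.rev.repr_subdiag fun j => (hbv j).symm] at h1
  simpa using h1

/-- A split basis is determined up to a scalar, so the entries `φ` are unique. -/
theorem IsSplitBasis.unique {φ φ' : Fin d → K} {b b' : Basis (Fin (d + 1)) K V}
    (hw : IsEigenbasis B Es θs w)
    (h : IsSplitBasis A B θ θs φ b) (h' : IsSplitBasis A B θ θs φ' b') : φ = φ' := by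
  have hmem : ∀ {φ : Fin d → K} {b : Basis (Fin (d + 1)) K V}, IsSplitBasis A B θ θs φ b →
      b 0 ∈ Submodule.span K {w 0} := fun h => by
    rw [← hw.eigenspace_eq]
    exact End.mem_eigenspace_iff.2 h.upper.zero
  obtain ⟨a, ha⟩ := Submodule.mem_span_singleton.1 (hmem h)
  obtain ⟨a', ha'⟩ := Submodule.mem_span_singleton.1 (hmem h')
  have hne : a' ≠ 0 := by
    rintro rfl
    exact b'.ne_zero 0 (by rw [← ha', zero_smul])
  have hb : ∀ i, b i = (a * a'⁻¹) • b' i := by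
    intro i
    induction i using Fin.induction with
    | zero => rw [← ha, ← ha', smul_smul, inv_mul_cancel_right₀ hne]
    | succ k ih =>
      have h1 := h.lower.castSucc k
      have h2 := h'.lower.castSucc k
      rw [ih, map_smul, h2, smul_add, smul_comm] at h1
      simpa using (add_left_cancel h1).symm
  have hne' : a * a'⁻¹ ≠ 0 := fun h0 => b.ne_zero 0 (by rw [hb, h0, zero_smul])
  funext k
  have h1 := h.upper.succ k
  have h2 := h'.upper.succ k
  rw [hb, hb, map_smul, h2, smul_add, smul_comm, smul_comm _ (φ' k)] at h1
  have h3 := add_left_cancel h1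
  exact (smul_left_injective K (smul_ne_zero hne' (b'.ne_zero _)) h3).symm

end SplitBasis

/-! ### Split decomposition and split sequence of a TH system. -/

namespace THSystemOn

variable {K : Type u} [Field K] {V : Type v} [AddCommGroup V] [Module K V]
  {W : Type w} [AddCommGroup W] [Module K W] {d : ℕ}

theorem exists_split_data (Φ : THSystemOn K V d) {θ θs : Fin (d + 1) → K}
    (hθ : Φ.IsEigenvalueSeq θ) (hθs : Φ.IsDualEigenvalueSeq θs) :
    Function.Injective θ ∧ Function.Injective θs ∧
    ∃ (φ : Fin d → K) (b : Basis (Fin (d + 1)) K V), (∀ k, φ k ≠ 0) ∧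
      IsSplitBasis Φ.A Φ.Astar θ θs φ b ∧ ∀ i, Φ.split i = Submodule.span K {b i} := by
  obtain ⟨v, hv⟩ := Φ.ordering.exists_eigenbasis Φ.multFree Φ.finrank_eq hθ
  obtain ⟨w, hw⟩ := Φ.ordering_star.exists_eigenbasis Φ.multFree_star Φ.finrank_eq hθs
  obtain ⟨φ, b, hφ, hb, hsp⟩ := exists_isSplitBasis hv hw Φ.hessenberg Φ.hessenberg_star
  refine ⟨hv.injective, hw.injective, φ, b, hφ, hb, fun i => ?_⟩
  rw [← hsp, split, hw.iSup_range_proj, hv.iSup_range_proj]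

/-- The split sequence can be read off from any split basis. -/
theorem isSplitSeq_iff (Φ : THSystemOn K V d) {θ θs : Fin (d + 1) → K} {φ : Fin d → K}
    (hθ : Φ.IsEigenvalueSeq θ) (hθs : Φ.IsDualEigenvalueSeq θs) :
    Φ.IsSplitSeq θ θs φ ↔
      ∃ b : Basis (Fin (d + 1)) K V, IsSplitBasis Φ.A Φ.Astar θ θs φ b := by
  obtain ⟨-, -, φ', b', -, hb', hsp⟩ := Φ.exists_split_data hθ hθs
  obtain ⟨w, hw⟩ := Φ.ordering_star.exists_eigenbasis Φ.multFree_star Φ.finrank_eq hθs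
  -- The right factor sends `b' k.succ` to `φ' k • b' k.castSucc`, and the left factor sends `b'
  -- k.castSucc` back to `b' k.succ`.
  have hact : ∀ k : Fin d, ((Φ.A - θ (Fin.rev k.castSucc) • (1 : End K V)) *
      (Φ.Astar - θs k.succ • (1 : End K V))) (b' k.succ) = φ' k • b' k.succ := by
    intro k
    have h1 := hb'.upper.succ k
    have h2 := hb'.lower.castSucc k
    simp [h1, h2]
  constructor
  · intro h
    have e : φ = φ' := by
      funext k
      have h1 := (h k).2 (b' k.succ) (by rw [hsp]; exact Submodule.mem_span_singleton_self _)
      rw [hact] at h1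
      exact (smul_left_injective K (b'.ne_zero _) h1).symm
    exact ⟨b', e ▸ hb'⟩
  · rintro ⟨b, hb⟩
    obtain rfl := hb.unique hw hb'
    intro k
    rw [hsp]
    refine ⟨by simpa using b'.ne_zero k.succ, fun x hx => ?_⟩
    obtain ⟨c, rfl⟩ := Submodule.mem_span_singleton.1 hx
    rw [map_smul, hact, smul_comm]

end THSystemOn

/-! ### Conjugation, rescaling and construction from split bases. -/

theorem isPrimitiveIdempotent_conj {K : Type u} [Field K] {V : Type v} [AddCommGroup V]
    [Module K V] {W : Type w} [AddCommGroup W] [Module K W] (f : V ≃ₗ[K] W) {A F : End K V} {μ : K}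
    (h : IsPrimitiveIdempotent A μ F) : IsPrimitiveIdempotent (f.conj A) μ (f.conj F) := by
  have he : ∀ {ν : K} {x : W}, x ∈ (f.conj A).eigenspace ν → f.symm x ∈ A.eigenspace ν := by
    intro ν x hx
    rw [End.mem_eigenspace_iff] at hx ⊢
    rw [← map_smul, ← hx]
    simp [LinearEquiv.conj_apply]
  refine ⟨?_, fun x hx => ?_, fun ν hν x hx => ?_⟩
  · obtain ⟨x, hx, hx0⟩ := h.1.exists_hasEigenvector
    refine End.hasEigenvalue_of_hasEigenvector (x := f x)
      ⟨End.mem_eigenspace_iff.2 ?_, by simpa using hx0⟩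
    simp [LinearEquiv.conj_apply, End.mem_eigenspace_iff.1 hx]
  · simp [LinearEquiv.conj_apply, h.2.1 _ (he hx)]
  · simp [LinearEquiv.conj_apply, h.2.2 ν hν _ (he hx)]

theorem IsPrimitiveIdempotent.eq {K : Type u} [Field K] {V : Type v} [AddCommGroup V]
    [Module K V] {A F G : End K V} {μ : K} (hA : IsMultiplicityFree A)
    (hF : IsPrimitiveIdempotent A μ F) (hG : IsPrimitiveIdempotent A μ G) : F = G := by
  have h : (⊤ : Submodule K V) ≤ LinearMap.eqLocus F G := by
    rw [← hA.1]
    refine iSup_le fun ν x hx => ?_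
    rw [LinearMap.mem_eqLocus]
    by_cases hν : ν = μ
    · subst hν
      rw [hF.2.1 x hx, hG.2.1 x hx]
    · rw [hF.2.2 ν hν x hx, hG.2.2 ν hν x hx]
  exact LinearMap.ext fun x => h trivial

namespace IsSplitBasis

variable {K : Type u} [Field K] {V : Type v} [AddCommGroup V] [Module K V]
  {W : Type w} [AddCommGroup W] [Module K W] {d : ℕ} {A B : End K V} {θ θs : Fin (d + 1) → K}
  {φ : Fin d → K} {b : Basis (Fin (d + 1)) K V}

theorem conj (h : IsSplitBasis A B θ θs φ b) (f : V ≃ₗ[K] W) :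
    IsSplitBasis (f.conj A) (f.conj B) θ θs φ (b.map f) where
  lower := ⟨fun k => by simp [LinearEquiv.conj_apply, h.lower.castSucc],
    by simp [LinearEquiv.conj_apply, h.lower.last]⟩
  upper := ⟨by simp [LinearEquiv.conj_apply, h.upper.zero],
    fun k => by simp [LinearEquiv.conj_apply, h.upper.succ]⟩

theorem operators_eq {A' B' : End K V} (h : IsSplitBasis A B θ θs φ b)
    (h' : IsSplitBasis A' B' θ θs φ b) : A = A' ∧ B = B' := by
  constructor
  · refine b.ext fun i => ?_
    induction i using Fin.lastCases with
    | last => rw [h.lower.last, h'.lower.last]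
    | cast k => rw [h.lower.castSucc, h'.lower.castSucc]
  · refine b.ext fun i => ?_
    induction i using Fin.cases with
    | zero => rw [h.upper.zero, h'.upper.zero]
    | succ k => rw [h.upper.succ, h'.upper.succ]

/-- Rescaling the `i`-th vector by `α ^ i` turns a split basis for `(A, B)` into one for an affine
transformation of `(A, B)`. -/
theorem affine (h : IsSplitBasis A B θ θs φ b) {α αs : K} (hα : α ≠ 0) (β βs : K) :
    IsSplitBasis (α • A + β • (1 : End K V)) (αs • B + βs • (1 : End K V))
      (fun i => α * θ i + β) (fun i => αs * θs i + βs) (fun k => α * αs * φ k)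
      (b.unitsSMul fun i => Units.mk0 α hα ^ (i : ℕ)) := by
  refine ⟨⟨fun k => ?_, ?_⟩, ⟨?_, fun k => ?_⟩⟩
  · simp only [Basis.unitsSMul_apply, Units.smul_def, map_smul, LinearMap.add_apply,
      LinearMap.smul_apply, End.one_apply, h.lower.castSucc, Function.comp_apply, Fin.val_castSucc,
      Fin.val_succ, Units.val_pow_eq_pow_val, Units.val_mk0, Pi.one_apply,
      pow_succ, Units.val_mul]
    module
  · simp only [Basis.unitsSMul_apply, Units.smul_def, map_smul, LinearMap.add_apply,
      LinearMap.smul_apply, End.one_apply, h.lower.last, Function.comp_apply]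
    module
  · simp only [Basis.unitsSMul_apply, Units.smul_def, map_smul, LinearMap.add_apply,
      LinearMap.smul_apply, End.one_apply, h.upper.zero]
    module
  · simp only [Basis.unitsSMul_apply, Units.smul_def, map_smul, LinearMap.add_apply,
      LinearMap.smul_apply, End.one_apply, h.upper.succ, Fin.val_castSucc,
      Fin.val_succ, Units.val_pow_eq_pow_val, Units.val_mk0, pow_succ, Units.val_mul]
    module

/-- For nonzero `φ` and distinct `θ`, `θs`, a split basis gives rise to a TH system. -/
theorem exists_thSystemOn (h : IsSplitBasis A B θ θs φ b) (hθ : Function.Injective θ)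
    (hθs : Function.Injective θs) (hφ : ∀ k, φ k ≠ 0) :
    ∃ Φ : THSystemOn K V d, Φ.A = A ∧ Φ.Astar = B ∧ Φ.IsEigenvalueSeq θ ∧
      Φ.IsDualEigenvalueSeq θs := by
  have hrr : (θ ∘ Fin.rev) ∘ Fin.rev = θ := by
    funext i
    simp
  -- Reversal makes `A` upper bidiagonal with diagonal `θ` in its own order.
  have hA := h.lower.rev
  rw [hrr] at hA
  obtain ⟨v, hv, hvb⟩ := hA.exists_eigenbasis hθ
  obtain ⟨w, hw, hwb⟩ := h.upper.exists_eigenbasis hθs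
  have hv' := isEigenbasis_basisProj hθ hv
  have hw' := isEigenbasis_basisProj hθs hw
  exact ⟨{
    A := A
    E := basisProj v
    Astar := B
    Estar := basisProj w
    finrank_eq := by rw [finrank_eq_card_basis b, Fintype.card_fin]
    multFree := hv'.isMultiplicityFree
    multFree_star := hw'.isMultiplicityFree
    ordering := hv'.isIdempotentOrdering
    ordering_star := hw'.isIdempotentOrdering
    hessenberg := h.upper.rev.isHessenbergFor (fun k => hφ _) hv' hvb
    hessenberg_star := h.lower.isHessenbergFor (fun k => one_ne_zero) hw' hwb }, rfl, rfl,
    hv'.isPrimitiveIdempotent, hw'.isPrimitiveIdempotent⟩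

end IsSplitBasis

theorem exists_isSplitBasis_of_basis {K : Type u} [Field K] {V : Type v} [AddCommGroup V]
    [Module K V] {d : ℕ} (b : Basis (Fin (d + 1)) K V) (θ θs : Fin (d + 1) → K) (φ : Fin d → K) :
    ∃ A B : End K V, IsSplitBasis A B θ θs φ b := by
  -- The default `0` covers the end of the basis with no neighbour: the last vector for `A`, the
  -- first for `B`.
  refine ⟨b.constr K fun i => θ i.rev • b i +
      Fin.lastCases (motive := fun _ => V) 0 (fun k => b k.succ) i,
    b.constr K fun i => θs i • b i +
      Fin.cases (motive := fun _ => V) 0 (fun k => φ k • b k.castSucc) i,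
    ⟨fun k => ?_, ?_⟩, ⟨?_, fun k => ?_⟩⟩ <;>
    rw [Basis.constr_basis] <;> simp

/-! ### Classification by parameter arrays. -/

section ParameterArray

variable {K : Type u} [Field K] {d : ℕ}

namespace THSystem

theorem isParameterArrayOf_iff {Φ : THSystem.{u, v} K d} {p : ParameterArray K d} :
    Φ.IsParameterArrayOf p ↔ Φ.sys.IsEigenvalueSeq p.θ ∧ Φ.sys.IsDualEigenvalueSeq p.θs ∧
      ∃ b : Basis (Fin (d + 1)) K Φ.V, IsSplitBasis Φ.sys.A Φ.sys.Astar p.θ p.θs p.φ b :=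
  and_congr_right fun h => and_congr_right fun hs => Φ.sys.isSplitSeq_iff h hs

theorem exists_isParameterArrayOf (Φ : THSystem.{u, v} K d) :
    ∃ p : ParameterArray K d, Φ.IsParameterArrayOf p := by
  obtain ⟨θ, hθ⟩ := Φ.sys.ordering.exists_eigenvalues
  obtain ⟨θs, hθs⟩ := Φ.sys.ordering_star.exists_eigenvalues
  obtain ⟨hi, his, φ, b, hφ, hb, -⟩ := Φ.sys.exists_split_data hθ hθs
  exact ⟨⟨θ, θs, φ, fun _ _ h => hi.ne h, fun _ _ h => his.ne h, hφ⟩,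
    isParameterArrayOf_iff.2 ⟨hθ, hθs, b, hb⟩⟩

theorem IsParameterArrayOf.unique {Φ : THSystem.{u, v} K d} {p q : ParameterArray K d}
    (hp : Φ.IsParameterArrayOf p) (hq : Φ.IsParameterArrayOf q) : p = q := by
  obtain ⟨θ, θs, φ, h1, h2, h3⟩ := p
  obtain ⟨θ', θs', φ', h1', h2', h3'⟩ := q
  obtain ⟨hp1, hp2, b, hb⟩ := isParameterArrayOf_iff.1 hp
  obtain ⟨hq1, hq2, b', hb'⟩ := isParameterArrayOf_iff.1 hq
  obtain rfl : θ = θ' := funext fun i => (hp1 i).eigenvalue_unique (hq1 i)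
  obtain rfl : θs = θs' := funext fun i => (hp2 i).eigenvalue_unique (hq2 i)
  obtain ⟨w, hw⟩ := Φ.sys.ordering_star.exists_eigenbasis Φ.sys.multFree_star Φ.sys.finrank_eq hp2
  obtain rfl : φ = φ' := hb.unique hw hb'
  rfl

theorem isomorphic_iff {Φ Ψ : THSystem.{u, v} K d} {p : ParameterArray K d}
    (hp : Φ.IsParameterArrayOf p) : Φ.sys.Isomorphic Ψ.sys ↔ Ψ.IsParameterArrayOf p := by
  obtain ⟨h1, h2, b, hb⟩ := isParameterArrayOf_iff.1 hp
  rw [isParameterArrayOf_iff]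
  constructor
  · rintro ⟨γ, hA, hAs, hE, hEs⟩
    -- Every algebra isomorphism between endomorphism rings is conjugation by a linear equivalence.
    obtain ⟨f, rfl⟩ := γ.eq_linearEquivConjAlgEquiv
    refine ⟨fun i => ?_, fun i => ?_, b.map f, ?_⟩
    · rw [hA, hE]
      exact isPrimitiveIdempotent_conj f (h1 i)
    · rw [hAs, hEs]
      exact isPrimitiveIdempotent_conj f (h2 i)
    · rw [hA, hAs]
      exact hb.conj f
  · rintro ⟨h1', h2', b', hb'⟩
    -- Matching the split bases carries `A` and `A*` across; the idempotents follow, being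
    -- determined by operator and eigenvalue.
    let f := b.equiv b' (Equiv.refl _)
    have hf : b.map f = b' := Basis.eq_of_apply_eq fun i => by simp [f]
    obtain ⟨hA, hAs⟩ := (hf ▸ hb.conj f).operators_eq hb'
    refine ⟨f.conjAlgEquiv K, hA.symm, hAs.symm, fun i => ?_, fun i => ?_⟩
    · exact (h1' i).eq Ψ.sys.multFree (hA ▸ isPrimitiveIdempotent_conj f (h1 i))
    · exact (h2' i).eq Ψ.sys.multFree_star (hAs ▸ isPrimitiveIdempotent_conj f (h2 i))

theorem exists_of_parameterArray (p : ParameterArray K d) :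
    ∃ Φ : THSystem.{u, max u v} K d, Φ.IsParameterArrayOf p := by
  -- `ULift` places `K^(d+1)` in the universe `max u v`.
  let b : Basis (Fin (d + 1)) K (ULift.{v} (Fin (d + 1) → K)) :=
    (Pi.basisFun K (Fin (d + 1))).map ULift.moduleEquiv.symm
  obtain ⟨A, B, h⟩ := exists_isSplitBasis_of_basis b p.θ p.θs p.φ
  obtain ⟨Φ, rfl, rfl, h1, h2⟩ := h.exists_thSystemOn
    (fun i j hij => by_contra fun hne => p.θ_ne i j hne hij)
    (fun i j hij => by_contra fun hne => p.θs_ne i j hne hij) p.φ_ne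
  exact ⟨⟨_, Φ⟩, isParameterArrayOf_iff.2 ⟨h1, h2, b, h⟩⟩

end THSystem

/-- The affine transformation of a parameter array. -/
def ParameterArray.affine (p : ParameterArray K d) (α β αs βs : K) (hα : α ≠ 0) (hαs : αs ≠ 0) :
    ParameterArray K d where
  θ i := α * p.θ i + β
  θs i := αs * p.θs i + βs
  φ k := α * αs * p.φ k
  θ_ne i j hij e := p.θ_ne i j hij (mul_left_cancel₀ hα (add_right_cancel e))
  θs_ne i j hij e := p.θs_ne i j hij (mul_left_cancel₀ hαs (add_right_cancel e))
  φ_ne k := mul_ne_zero (mul_ne_zero hα hαs) (p.φ_ne k)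

theorem ParameterArray.affineRelated_iff {p q : ParameterArray K d} :
    p.AffineRelated q ↔ ∃ (α β αs βs : K) (hα : α ≠ 0) (hαs : αs ≠ 0),
      q = p.affine α β αs βs hα hαs := by
  constructor
  · rintro ⟨α, β, αs, βs, hα, hαs, h1, h2, h3⟩
    exact ⟨α, β, αs, βs, hα, hαs, ParameterArray.ext (funext h1) (funext h2) (funext h3)⟩
  · rintro ⟨α, β, αs, βs, hα, hαs, rfl⟩
    exact ⟨α, β, αs, βs, hα, hαs, fun _ => rfl, fun _ => rfl, fun _ => rfl⟩

/-- The affine transformation of a TH system. -/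
def THSystem.affine (Φ : THSystem.{u, v} K d) (α β αs βs : K) (hα : α ≠ 0) (hαs : αs ≠ 0) :
    THSystem.{u, v} K d :=
  ⟨Φ.V, Φ.sys.affine α β αs βs hα hαs⟩

theorem THSystem.IsParameterArrayOf.affine {Φ : THSystem.{u, v} K d} {p : ParameterArray K d}
    (hp : Φ.IsParameterArrayOf p) (α β αs βs : K) (hα : α ≠ 0) (hαs : αs ≠ 0) :
    (Φ.affine α β αs βs hα hαs).IsParameterArrayOf (p.affine α β αs βs hα hαs) := by
  obtain ⟨h1, h2, b, hb⟩ := isParameterArrayOf_iff.1 hp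
  exact isParameterArrayOf_iff.2 ⟨fun i => (isPrimitiveIdempotent_affine _ hα _ _ _).2 (h1 i),
    fun i => (isPrimitiveIdempotent_affine _ hαs _ _ _).2 (h2 i), _, hb.affine hα β βs⟩

/-- The relation runs from `q` to `p` because affine isomorphism transforms the second system, and
the same four scalars serve on both sides. -/
theorem THSystem.affineIsomorphic_iff {Φ Ψ : THSystem.{u, v} K d} {p q : ParameterArray K d}
    (hp : Φ.IsParameterArrayOf p) (hq : Ψ.IsParameterArrayOf q) :
    Φ.sys.AffineIsomorphic Ψ.sys ↔ q.AffineRelated p := by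
  rw [ParameterArray.affineRelated_iff]
  refine exists_congr fun α => exists_congr fun β => exists_congr fun αs => exists_congr fun βs =>
    exists_congr fun hα => exists_congr fun hαs => ?_
  have hq' := hq.affine α β αs βs hα hαs
  have h := isomorphic_iff (Ψ := Ψ.affine α β αs βs hα hαs) hp
  exact h.trans ⟨fun h' => h'.unique hq', fun e => e ▸ hq'⟩

/-- The parameter array of a TH system. -/
noncomputable def THSystem.parameterArray (Φ : THSystem.{u, v} K d) : ParameterArray K d :=
  Φ.exists_isParameterArrayOf.choose

theorem THSystem.isParameterArrayOf_parameterArray (Φ : THSystem.{u, v} K d) :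
    Φ.IsParameterArrayOf Φ.parameterArray :=
  Φ.exists_isParameterArrayOf.choose_spec

theorem THSystem.parameterArray_eq_iff {Φ : THSystem.{u, v} K d} {p : ParameterArray K d} :
    Φ.parameterArray = p ↔ Φ.IsParameterArrayOf p :=
  ⟨fun h => h ▸ Φ.isParameterArrayOf_parameterArray,
    fun h => Φ.isParameterArrayOf_parameterArray.unique h⟩

theorem THSystem.isomorphic_iff_parameterArray_eq {Φ Ψ : THSystem.{u, v} K d} :
    Φ.sys.Isomorphic Ψ.sys ↔ Φ.parameterArray = Ψ.parameterArray := by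
  rw [isomorphic_iff Φ.isParameterArrayOf_parameterArray, ← parameterArray_eq_iff, eq_comm]

theorem THSystem.affineIsomorphic_iff_affineRelated {Φ Ψ : THSystem.{u, v} K d} :
    Φ.sys.AffineIsomorphic Ψ.sys ↔ Φ.parameterArray.AffineRelated Ψ.parameterArray := by
  rw [affineIsomorphic_iff Φ.isParameterArrayOf_parameterArray Ψ.isParameterArrayOf_parameterArray]
  exact ⟨(ParameterArray.affineSetoid K d).symm', (ParameterArray.affineSetoid K d).symm'⟩

theorem THSystem.parameterArray_surjective :
    Function.Surjective (THSystem.parameterArray : THSystem.{u, max u v} K d → _) := fun p => by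
  obtain ⟨Φ, hΦ⟩ := exists_of_parameterArray.{u, v} p
  exact ⟨Φ, parameterArray_eq_iff.2 hΦ⟩

end ParameterArray

end ThinHess

/-! ### The two bijections on classes. -/

theorem corollary19p14 (K : Type u) [Field K] (d : ℕ) :
    ∃ π : ThinHess.IsoClass.{u, max u v} K d → ThinHess.ParameterArray K d,
      (∀ (Φ : ThinHess.THSystem.{u, max u v} K d) (p : ThinHess.ParameterArray K d),
        π (Quotient.mk (ThinHess.THSystem.isoSetoid.{u, max u v} K d) Φ) = p ↔
          Φ.IsParameterArrayOf p) ∧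
      Function.Bijective π ∧
      ∃ ρ : ThinHess.AffineIsoClass.{u, max u v} K d → ThinHess.ReducedParameterArray K d,
        (∀ Φ : ThinHess.THSystem.{u, max u v} K d,
          ρ (Quotient.mk (ThinHess.THSystem.affineSetoid.{u, max u v} K d) Φ) =
            Quotient.mk (ThinHess.ParameterArray.affineSetoid K d)
              (π (Quotient.mk (ThinHess.THSystem.isoSetoid.{u, max u v} K d) Φ))) ∧
        Function.Bijective ρ := by
  refine ⟨Quotient.lift ThinHess.THSystem.parameterArray
      fun Φ Ψ h => ThinHess.THSystem.isomorphic_iff_parameterArray_eq.1 h,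
    fun Φ p => ThinHess.THSystem.parameterArray_eq_iff, ⟨?_, fun p => ?_⟩,
    Quotient.map' ThinHess.THSystem.parameterArray
      fun Φ Ψ h => ThinHess.THSystem.affineIsomorphic_iff_affineRelated.1 h,
    fun Φ => rfl, ?_, fun p => ?_⟩
  · rintro ⟨Φ⟩ ⟨Ψ⟩ h
    exact Quotient.sound (ThinHess.THSystem.isomorphic_iff_parameterArray_eq.2 h)
  · obtain ⟨Φ, hΦ⟩ := ThinHess.THSystem.parameterArray_surjective.{u, v} p
    exact ⟨Quotient.mk _ Φ, hΦ⟩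
  · rintro ⟨Φ⟩ ⟨Ψ⟩ h
    exact Quotient.sound (ThinHess.THSystem.affineIsomorphic_iff_affineRelated.2 (Quotient.exact h))
  · obtain ⟨p⟩ := p
    obtain ⟨Φ, rfl⟩ := ThinHess.THSystem.parameterArray_surjective.{u, v} p
    exact ⟨Quotient.mk _ Φ, rfl⟩
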